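/- **Setting.** Graphs are finite, simple and undirected, with node set $\{1,\dots,n\}$ ($n$ may differ between graphs), adjacency matrix $A$ and node features $x_i\in\mathbb R^d$. Fix $d$, an output dimension, and an activation $\sigma:\mathbb R\to\mathbb R$ (for instance ReLU), applied pointwise. An MLP is a composition of affine maps with the activation between consecutive ones. **Policies.** A node-based policy $\pi$ assigns to each node (root) $k$ an induced subgraph $G^k$ of $G$ with node set $V^k$ and adjacency $\sim_k$, and initial features $x^k_i$: *node deletion* ND ($V^k$ is everything but $k$), *node marking* NM ($G^k=G$), *ego-nets* EGO($h$), $h>0$ ($V^k$ is the set of nodes at distance at most $h$ from $k$), *marked ego-nets* EGO+($h$). Here $x^k_i=x_i$, and for NM and EGO+ one channel is appended, equal to $1$ if $i=k$ and $0$ otherwise. Two conventions are allowed: nodes outside $V^k$ are kept in $G^k$ as isolated nodes with their features (then $V^k$ is replaced by $\{1,\dots,n\}$ in all sums below), or they are removed. **Models.** The class $\Upsilon$ consists of the following models, all with stacks of any number of layers (with the restriction stated for ID-GNN), any widths, and real weights. A *Deep Sets* network maps a family $(x^k)_k$ to $\psi(\sum_k\varphi(x^k))$, or applies layers $x^k\mapsto\sigma(W_1x^k+\sum_hW_2x^h)$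 and then outputs $\psi(\sum_k x^k)$, with MLPs $\varphi,\psi$. * *DS-GNN* with any of the above policies: layers $x^k_i\mapsto\sigma\big(W_1x^k_i+W_2\sum_{j\sim_k i}x^k_j\big)$ (Morris layers on the subgraphs), then $x^k=\sum_{i\in V^k}x^k_i$, then Deep Sets. *Reconstruction GNN* is the case of ND. * *DSS-GNN* with any of the above policies: the same readout, and layers $x^k_i\mapsto\sigma\big(W_1x^k_i+W_2\sum_{j\sim_k i}x^k_j+U_1y_i+U_2\sum_{j\sim i}y_j\big)$, where $y_i=\sum_{h:\,i\in V^h}x^h_i$ and $\sim$ is the adjacency of $G$. * *GNN-AK* and *GNN-AK-ctx* with EGO($h$), $h>0$: each layer first applies a stack of Morris layers on the subgraphs, giving $y^k_i$, and then sets, for all $k$, $x^k_i$ to the sum or to the concatenation of $y^i_i$ and $\sum_{j\in V^i}y^i_j$, and for GNN-AK-ctx also of $\sum_{h:\,i\in V^h}y^h_i$. The output is $\mu(\sum_kx^k_k)$ with an MLP $\mu$. * *NGNN* with EGO($h$), $h>0$: Morris layers on the subgraphs, then $z_k=\sum_{i\in V^k}x^k_i$, then Morris layers on $G$ applied to $z$;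 the output is $\mu(\sum_kz_k)$. * *ID-GNN* with $T\ge1$ layers and policy EGO+($T$): layers $x^k_i\mapsto\sigma\big(W_1x^k_i+W_2\sum_{j\sim_ki,\,j\ne k}x^k_j+\mathbf 1_{[k\sim_ki]}W_3x^k_k\big)$; the output is $\mu(\sum_kx^k_k)$. **3-IGNs.** A linear equivariant layer from order $k$ to order $k'$ maps $Y:[n]^k\to\mathbb R^{e}$ to $Y':[n]^{k'}\to\mathbb R^{e'}$ by $Y'_b=\sum_{a\in[n]^k}W_{\mathrm{pat}(a,b)}Y_a+\beta_{\mathrm{pat}(b)}$. Here $\mathrm{pat}$ is the equality pattern of a multi-index, and the matrices $W$ and vectors $\beta$ depend only on the pattern, not on $n$. A 3-IGN instance is $m\circ h\circ L^{(T)}\circ\mathrm{ReLU}\circ\cdots\circ\mathrm{ReLU}\circ L^{(1)}$, $T\ge1$, where the $L^{(t)}$ are linear equivariant layers whose outputs have order between $1$ and $3$, $h$ is such a layer to order $0$, and $m$ is a ReLU MLP. Its input is the order-two tensor whose first channel is $A$ and whose other $d$ channels hold the features $x_i$ on the diagonal and $0$ elsewhere. **Theorem.** Let $G_1,G_2$ be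 non-isomorphic graphs with node features in $\mathbb R^d$, and let $\mathcal N$ be a model in $\Upsilon$. If there are weights $\Theta$ with $\mathcal N_\Theta(G_1)\ne\mathcal N_\Theta(G_2)$, then there is a 3-IGN instance $\mathcal M_\Omega$ with $\mathcal M_\Omega(G_1)\ne\mathcal M_\Omega(G_2)$. -/

import Mathlib

open scoped Matrix BigOperators

noncomputable section

/-! ### Node-attributed graphs -/

/-- A finite, simple, undirected graph on the nodes `Fin n` with features in `ℝ^d` on its nodes. -/
structure AttrGraph (d : ℕ) where
  n : ℕ
  graph : SimpleGraph (Fin n)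
  feat : Fin n → Fin d → ℝ

/-- Isomorphism of node-attributed graphs. -/
def AttrGraph.Isomorphic {d : ℕ} (G₁ G₂ : AttrGraph d) : Prop :=
  ∃ e : G₁.graph ≃g G₂.graph, ∀ v, G₂.feat (e v) = G₁.feat v

/-! ### Multi-layer perceptrons and stacks of layers -/

/-- The ReLU non-linearity. -/
def relu (x : ℝ) : ℝ := max x 0

/-- (Weights of) a multi-layer perceptron `ℝ^a → ℝ^b` of arbitrary depth and hidden widths:
affine layers with a pointwise activation between consecutive ones. -/
inductive MLP : ℕ → ℕ → Type
  | affine {a b : ℕ} (W : Matrix (Fin b) (Fin a) ℝ) (β : Fin b → ℝ) : MLP a b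
  | hidden {a b c : ℕ} (W : Matrix (Fin b) (Fin a) ℝ) (β : Fin b → ℝ) (rest : MLP b c) : MLP a c

/-- The function computed by an MLP with activation `σ`. -/
def MLP.eval (σ : ℝ → ℝ) : {a b : ℕ} → MLP a b → (Fin a → ℝ) → (Fin b → ℝ)
  | _, _, .affine W β, x => W *ᵥ x + β
  | _, _, .hidden W β rest, x => rest.eval σ (fun i => σ ((W *ᵥ x + β) i))

/-- A finite sequence of composable layers; `L a b` is the type of layers from `a` to `b`
channels. -/
inductive Stack (L : ℕ → ℕ → Type) : ℕ → ℕ → Type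
  | nil (a : ℕ) : Stack L a a
  | cons {a b c : ℕ} (l : L a b) (rest : Stack L b c) : Stack L a c

/-- The number of layers of a stack. -/
def Stack.length {L : ℕ → ℕ → Type} : {a b : ℕ} → Stack L a b → ℕ
  | _, _, .nil _ => 0
  | _, _, .cons _ rest => rest.length + 1

/-- Applies the layers of a stack one after the other; `step` says what one layer does. -/
def Stack.run {L : ℕ → ℕ → Type} {F : ℕ → Type} (step : ∀ a b : ℕ, L a b → F a → F b) :
    {a b : ℕ} → Stack L a b → F a → F b
  | _, _, .nil _, x => x
  | _, _, .cons l rest, x => rest.run step (step _ _ l x)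

/-! ### Invariant graph networks of order three -/

/-- Tensors of order `k` over `n` nodes with `d` channels. -/
abbrev Tensor (n k d : ℕ) : Type := (Fin k → Fin n) → Fin d → ℝ

/-- The weights of a linear `Sₙ`-equivariant layer with bias from order `k` and `d` channels to
order `k'` and `d'` channels: a `d' × d` matrix for every equality pattern of a multi-index of
length `k + k'`, and a bias vector for every equality pattern of an output multi-index. An equality
pattern is a partition of the positions, that is, an equivalence relation on them. The weights
do not depend on the number `n` of nodes. -/
structure EquivLayer (k d k' d' : ℕ) where
  weight : Setoid (Fin k ⊕ Fin k') → Matrix (Fin d') (Fin d) ℝ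
  bias : Setoid (Fin k') → Fin d' → ℝ

/-- The action of a linear equivariant layer on tensors over `n` nodes: the linear combination of
the indicator tensors of the equality patterns, and the bias. -/
def EquivLayer.eval {k d k' d' : ℕ} (L : EquivLayer k d k' d') {n : ℕ} (Y : Tensor n k d) :
    Tensor n k' d' :=
  fun b => (∑ a : Fin k → Fin n, L.weight (Setoid.ker (Sum.elim a b)) *ᵥ Y a)
    + L.bias (Setoid.ker b)

/-- A stacking `L^(T) ∘ σ ∘ ⋯ ∘ σ ∘ L^(1)` of `T ≥ 1` linear equivariant layers, all of whose
layer outputs have order at most three. Indices: order and channels of the input, order and channels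
of the output. -/
inductive IGNStack : ℕ → ℕ → ℕ → ℕ → Type
  | single {k d k' d' : ℕ} (h1 : 1 ≤ k') (h3 : k' ≤ 3) (L : EquivLayer k d k' d') :
      IGNStack k d k' d'
  | cons {k d k' d' k'' d'' : ℕ} (h1 : 1 ≤ k') (h3 : k' ≤ 3) (L : EquivLayer k d k' d')
      (rest : IGNStack k' d' k'' d'') : IGNStack k d k'' d''

/-- The function computed by a stacking, with ReLU between consecutive layers. -/
def IGNStack.eval {n : ℕ} : {k d k' d' : ℕ} → IGNStack k d k' d' → Tensor n k d → Tensor n k' d'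
  | _, _, _, _, .single _ _ L, Y => L.eval Y
  | _, _, _, _, .cons _ _ L rest, Y => rest.eval (fun a c => relu (L.eval Y a c))

/-- A 3-IGN instance `m ∘ h ∘ 𝓘` for graphs with `d` node features: a stacking `𝓘` of linear
equivariant layers that starts from tensors of order two, an invariant linear layer `h`, and an
MLP `m`. -/
structure IGN3 (d out : ℕ) where
  k : ℕ
  e : ℕ
  f : ℕ
  stack : IGNStack 2 (d + 1) k e
  pool : EquivLayer k e 0 f
  mlp : MLP f out

open Classical in
/-- The order-two tensor that represents `(A, X)`: channel `0` holds the adjacency matrix, the other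
channels hold the node features on the diagonal. -/
def AttrGraph.tensor {d : ℕ} (G : AttrGraph d) : Tensor G.n 2 (d + 1) :=
  fun a => Fin.cons (α := fun _ => ℝ) (if G.graph.Adj (a 0) (a 1) then 1 else 0)
    (if a 0 = a 1 then G.feat (a 0) else 0)

/-- The output of a 3-IGN instance on a graph. -/
def IGN3.eval {d out : ℕ} (M : IGN3 d out) (G : AttrGraph d) : Fin out → ℝ :=
  M.mlp.eval relu (M.pool.eval (M.stack.eval G.tensor) Fin.elim0)

/-! ### Node-based selection policies -/

/-- The nodes at distance at most `h` from `v`. -/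
def hopBall {n : ℕ} (G : SimpleGraph (Fin n)) (h : ℕ) (v : Fin n) : Set (Fin n) :=
  {w | ∃ p : G.Walk v w, p.length ≤ h}

/-- The known node-based policies ND, NM, EGO(h), EGO+(h). -/
inductive Policy
  | nodeDeletion
  | nodeMarking
  | ego (h : ℕ) (hpos : 0 < h)
  | egoMarked (h : ℕ) (hpos : 0 < h)

/-- The number of node feature channels in the bag; marking adds one. -/
def Policy.dim : Policy → ℕ → ℕ
  | .nodeDeletion, d => d
  | .nodeMarking, d => d + 1
  | .ego _ _, d => d
  | .egoMarked _ _, d => d + 1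

/-- The subgraph with root `v` selected by a policy. -/
def Policy.subgraph {n : ℕ} (π : Policy) (G : SimpleGraph (Fin n)) (v : Fin n) : G.Subgraph :=
  match π with
  | .nodeDeletion => (⊤ : G.Subgraph).deleteVerts {v}
  | .nodeMarking => ⊤
  | .ego h _ => (⊤ : G.Subgraph).induce (hopBall G h v)
  | .egoMarked h _ => (⊤ : G.Subgraph).induce (hopBall G h v)

/-- Appends the mark: `1` at the root `k`, `0` at the other nodes. -/
def markRoot {n d : ℕ} (X : Fin n → Fin d → ℝ) (k i : Fin n) : Fin (d + 1) → ℝ :=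
  Fin.snoc (α := fun _ => ℝ) (X i) (if i = k then 1 else 0)

/-- The initial features in the bag: `π.feat X k i` is the feature vector of node `i` in the
subgraph with root `k`. -/
def Policy.feat {n d : ℕ} (π : Policy) (X : Fin n → Fin d → ℝ) :
    Fin n → Fin n → Fin (π.dim d) → ℝ :=
  match π with
  | .nodeDeletion => fun _ i => X i
  | .nodeMarking => markRoot X
  | .ego _ _ => fun _ i => X i
  | .egoMarked _ _ => markRoot X

/-- What happens to the nodes of the graph that a policy leaves out of a subgraph: either they are
kept as isolated nodes with their features, so that all subgraphs have `n` nodes and sums range over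
all of them, or they are really removed, so that sums range over the nodes of the subgraph only. -/
inductive NodeConvention
  | padded
  | removed

open Classical in
/-- The nodes that count as nodes of the subgraph `H`. -/
def NodeConvention.nodes {n : ℕ} {G : SimpleGraph (Fin n)} (c : NodeConvention)
    (H : G.Subgraph) : Finset (Fin n) :=
  match c with
  | .padded => Finset.univ
  | .removed => {i | i ∈ H.verts}

/-! ### Layers of subgraph GNNs -/

/-- Node representations in a bag: `x k i` is the one of node `i` in the subgraph with root `k`. -/
abbrev BagFeat (n d : ℕ) : Type := Fin n → Fin n → Fin d → ℝ

open Classical in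
/-- The sum of the representations of the neighbours of `i`. -/
def neighborSum {n d : ℕ} (adj : Fin n → Fin n → Prop) (x : Fin n → Fin d → ℝ) (i : Fin n) :
    Fin d → ℝ :=
  ∑ j with adj i j, x j

/-- The sum of the representations of all nodes of subgraph `k`. -/
def nodeSum {n d : ℕ} (V : Fin n → Finset (Fin n)) (x : BagFeat n d) (k : Fin n) : Fin d → ℝ :=
  ∑ i ∈ V k, x k i

/-- The sum of the representations of node `i` in all subgraphs that contain it. -/
def crossSum {n d : ℕ} (V : Fin n → Finset (Fin n)) (x : BagFeat n d) (i : Fin n) : Fin d → ℝ :=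
  ∑ k with i ∈ V k, x k i

/-- Message-passing layer `x_i ↦ σ(W₁ x_i + W₂ ∑_{j ∼ i} x_j)`. -/
structure MorrisLayer (a b : ℕ) where
  W₁ : Matrix (Fin b) (Fin a) ℝ
  W₂ : Matrix (Fin b) (Fin a) ℝ

def MorrisLayer.eval (σ : ℝ → ℝ) {n : ℕ} (adj : Fin n → Fin n → Prop) (a b : ℕ)
    (L : MorrisLayer a b) (x : Fin n → Fin a → ℝ) : Fin n → Fin b → ℝ :=
  fun i c => σ ((L.W₁ *ᵥ x i + L.W₂ *ᵥ neighborSum adj x i) c)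

/-- The same message-passing layer applied to every subgraph on its own. -/
def MorrisLayer.evalBag (σ : ℝ → ℝ) {n : ℕ} {G : SimpleGraph (Fin n)} (H : Fin n → G.Subgraph)
    (a b : ℕ) (L : MorrisLayer a b) (x : BagFeat n a) : BagFeat n b :=
  fun k => L.eval σ (H k).Adj a b (x k)

/-- DSS-GNN layer: `W₁, W₂` act within the subgraph, `U₁, U₂` on the representations summed over
the subgraphs, with the connectivity of the original graph. -/
structure DSSLayer (a b : ℕ) where
  W₁ : Matrix (Fin b) (Fin a) ℝ
  W₂ : Matrix (Fin b) (Fin a) ℝ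
  U₁ : Matrix (Fin b) (Fin a) ℝ
  U₂ : Matrix (Fin b) (Fin a) ℝ

def DSSLayer.eval (σ : ℝ → ℝ) {n : ℕ} {G : SimpleGraph (Fin n)} (H : Fin n → G.Subgraph)
    (V : Fin n → Finset (Fin n)) (a b : ℕ) (L : DSSLayer a b) (x : BagFeat n a) : BagFeat n b :=
  fun k i c => σ ((L.W₁ *ᵥ x k i + L.W₂ *ᵥ neighborSum (H k).Adj (x k) i
    + L.U₁ *ᵥ crossSum V x i + L.U₂ *ᵥ neighborSum G.Adj (crossSum V x) i) c)

/-- GNN-AK layer: a stack of message-passing layers, then aggregation by summation or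
concatenation. -/
inductive AKLayer : ℕ → ℕ → Type
  | sum {a b : ℕ} (S : Stack MorrisLayer a b) : AKLayer a b
  | concat {a b : ℕ} (S : Stack MorrisLayer a b) : AKLayer a (b + b)

def AKLayer.eval (σ : ℝ → ℝ) {n : ℕ} {G : SimpleGraph (Fin n)} (H : Fin n → G.Subgraph)
    (V : Fin n → Finset (Fin n)) : (a b : ℕ) → AKLayer a b → BagFeat n a → BagFeat n b
  | _, _, .sum S, x =>
      let y := S.run (F := BagFeat n) (MorrisLayer.evalBag σ H) x
      fun _ i => y i i + nodeSum V y i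
  | _, _, .concat S, x =>
      let y := S.run (F := BagFeat n) (MorrisLayer.evalBag σ H) x
      fun _ i => Fin.append (y i i) (nodeSum V y i)

/-- GNN-AK-ctx layer: like a GNN-AK layer, but also aggregating over the subgraphs. -/
inductive AKCtxLayer : ℕ → ℕ → Type
  | sum {a b : ℕ} (S : Stack MorrisLayer a b) : AKCtxLayer a b
  | concat {a b : ℕ} (S : Stack MorrisLayer a b) : AKCtxLayer a (b + b + b)

def AKCtxLayer.eval (σ : ℝ → ℝ) {n : ℕ} {G : SimpleGraph (Fin n)} (H : Fin n → G.Subgraph)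
    (V : Fin n → Finset (Fin n)) : (a b : ℕ) → AKCtxLayer a b → BagFeat n a → BagFeat n b
  | _, _, .sum S, x =>
      let y := S.run (F := BagFeat n) (MorrisLayer.evalBag σ H) x
      fun _ i => y i i + nodeSum V y i + crossSum V y i
  | _, _, .concat S, x =>
      let y := S.run (F := BagFeat n) (MorrisLayer.evalBag σ H) x
      fun _ i => Fin.append (Fin.append (y i i) (nodeSum V y i)) (crossSum V y i)

/-- ID-GNN layer: messages from the root get their own weight matrix `W₃`. -/
structure IDLayer (a b : ℕ) where
  W₁ : Matrix (Fin b) (Fin a) ℝ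
  W₂ : Matrix (Fin b) (Fin a) ℝ
  W₃ : Matrix (Fin b) (Fin a) ℝ

open Classical in
def IDLayer.eval (σ : ℝ → ℝ) {n : ℕ} {G : SimpleGraph (Fin n)} (H : Fin n → G.Subgraph)
    (a b : ℕ) (L : IDLayer a b) (x : BagFeat n a) : BagFeat n b :=
  fun k i c => σ ((L.W₁ *ᵥ x k i
    + L.W₂ *ᵥ neighborSum (fun i j => (H k).Adj i j ∧ j ≠ k) (x k) i
    + if (H k).Adj k i then L.W₃ *ᵥ x k k else 0) c)

/-- Layer on sets: `x_k ↦ σ(W₁ x_k + ∑_h W₂ x_h)`. -/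
structure SetLayer (a b : ℕ) where
  W₁ : Matrix (Fin b) (Fin a) ℝ
  W₂ : Matrix (Fin b) (Fin a) ℝ

def SetLayer.eval (σ : ℝ → ℝ) {n : ℕ} (a b : ℕ) (L : SetLayer a b) (x : Fin n → Fin a → ℝ) :
    Fin n → Fin b → ℝ :=
  fun k c => σ ((L.W₁ *ᵥ x k + ∑ h, L.W₂ *ᵥ x h) c)

/-- Deep Sets network on the set of subgraph representations: either `ψ(∑_k φ(x_k))`, or a stack of
layers on sets followed by `ψ(∑_k x_k)`. -/
inductive DeepSets : ℕ → ℕ → Type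
  | early {a b out : ℕ} (φ : MLP a b) (ψ : MLP b out) : DeepSets a out
  | late {a b out : ℕ} (S : Stack SetLayer a b) (ψ : MLP b out) : DeepSets a out

def DeepSets.eval (σ : ℝ → ℝ) {n : ℕ} :
    {a out : ℕ} → DeepSets a out → (Fin n → Fin a → ℝ) → (Fin out → ℝ)
  | _, _, .early φ ψ, x => ψ.eval σ (∑ k, φ.eval σ (x k))
  | _, _, .late S ψ, x =>
      ψ.eval σ (∑ k, S.run (F := fun a => Fin n → Fin a → ℝ) (SetLayer.eval σ) x k)

/-! ### Known node-based subgraph GNNs -/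

/-- Instances (architecture and weights) of the known node-based subgraph GNNs with message-passing
base encoders, for graphs with `d` node features. -/
inductive SubgraphGNN (d out : ℕ) : Type
  | reconstruction {e : ℕ} (S : Stack MorrisLayer d e) (R : DeepSets e out)
  | gnnAK (h : ℕ) (hpos : 0 < h) {e : ℕ} (S : Stack AKLayer d e) (μ : MLP e out)
  | gnnAKctx (h : ℕ) (hpos : 0 < h) {e : ℕ} (S : Stack AKCtxLayer d e) (μ : MLP e out)
  | ngnn (h : ℕ) (hpos : 0 < h) {e f : ℕ} (S : Stack MorrisLayer d e)
      (γ : Stack MorrisLayer e f) (μ : MLP f out)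
  | idGNN {e : ℕ} (S : Stack IDLayer (d + 1) e) (hpos : 0 < S.length) (μ : MLP e out)
  | dsGNN (π : Policy) {e : ℕ} (S : Stack MorrisLayer (π.dim d) e) (R : DeepSets e out)
  | dssGNN (π : Policy) {e : ℕ} (S : Stack DSSLayer (π.dim d) e) (R : DeepSets e out)

/-- The output of DS-GNN with policy `π`: message passing on each subgraph, sum over the nodes of
each subgraph, Deep Sets network. -/
def evalDS {d e out : ℕ} (σ : ℝ → ℝ) (c : NodeConvention) (G : AttrGraph d) (π : Policy)
    (S : Stack MorrisLayer (π.dim d) e) (R : DeepSets e out) : Fin out → ℝ :=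
  let H := π.subgraph G.graph
  R.eval σ (nodeSum (fun k => c.nodes (H k))
    (S.run (F := BagFeat G.n) (MorrisLayer.evalBag σ H) (π.feat G.feat)))

/-- The output of a subgraph GNN instance with activation `σ` on a graph. -/
def SubgraphGNN.eval {d out : ℕ} (σ : ℝ → ℝ) (c : NodeConvention) (N : SubgraphGNN d out)
    (G : AttrGraph d) : Fin out → ℝ :=
  match N with
  | .reconstruction S R => evalDS σ c G .nodeDeletion S R
  | .gnnAK h hpos S μ =>
      let π := Policy.ego h hpos
      let H := π.subgraph G.graph
      let x := S.run (F := BagFeat G.n) (AKLayer.eval σ H (fun k => c.nodes (H k)))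
        (π.feat G.feat)
      μ.eval σ (∑ k, x k k)
  | .gnnAKctx h hpos S μ =>
      let π := Policy.ego h hpos
      let H := π.subgraph G.graph
      let x := S.run (F := BagFeat G.n) (AKCtxLayer.eval σ H (fun k => c.nodes (H k)))
        (π.feat G.feat)
      μ.eval σ (∑ k, x k k)
  | .ngnn h hpos S γ μ =>
      let π := Policy.ego h hpos
      let H := π.subgraph G.graph
      let x := S.run (F := BagFeat G.n) (MorrisLayer.evalBag σ H) (π.feat G.feat)
      let z := γ.run (F := fun a => Fin G.n → Fin a → ℝ) (MorrisLayer.eval σ G.graph.Adj)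
        (nodeSum (fun k => c.nodes (H k)) x)
      μ.eval σ (∑ v, z v)
  | .idGNN S hpos μ =>
      let π := Policy.egoMarked S.length hpos
      let H := π.subgraph G.graph
      let x := S.run (F := BagFeat G.n) (IDLayer.eval σ H) (π.feat G.feat)
      μ.eval σ (∑ k, x k k)
  | .dsGNN π S R => evalDS σ c G π S R
  | .dssGNN π S R =>
      let H := π.subgraph G.graph
      let V := fun k => c.nodes (H k)
      R.eval σ (nodeSum V
        (S.run (F := BagFeat G.n) (DSSLayer.eval σ H V) (π.feat G.feat)))

end

/-! A bag of subgraphs is an order-two object, indexed by root and node, and every update sums over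
at most one more index. Tensors of order three therefore have room for every layer.

Only two graphs have to be separated, so exact simulation on a finite family is enough. There a
tensor takes finitely many real values, and on a finite set any function agrees with a combination
of constants and shifted ReLUs (`exists_relu_interpolation`). Hence 3-IGNs can apply an arbitrary
activation pointwise (`IGNDefinable.comp`), in particular squaring, which gives products
(`IGNDefinable.mul`) and so Boolean combinations of relations. Linear equivariant layers supply
permutation of indices, restriction to diagonals and summation over an index; together these give
existential quantification.

`IGNDefinable` packages this closure. It quantifies over every stacking that retains the input, so
that constructions can be chained while all earlier tensors stay available. Distance balls, the
subgraphs of each policy, and then each layer and readout are definable, with weights common to the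
whole family (`IGNDefinableVec.subgraphGNN`).

The model's output thus becomes a tensor that is constant on each graph, and summing its entries
gives `n ^ 3` times the output. For equal positive `n` this separates the graphs; for different `n`
the constant tensor `1` does. Non-isomorphism excludes the remaining case of two empty graphs. -/

theorem IGNStack.exists_snoc {k d k' d' e : ℕ} (s : IGNStack k d k' d')
    (L : EquivLayer k' d' 3 e) :
    ∃ s' : IGNStack k d 3 e, ∀ (n : ℕ) (Y : Tensor n k d),
      s'.eval Y = L.eval (fun a c => relu (s.eval Y a c)) := by
  induction s with
  | single h1 h3 L₀ =>
    exact ⟨.cons h1 h3 L₀ (.single (by norm_num) le_rfl L), fun n Y => rfl⟩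
  | cons h1 h3 L₀ rest ih =>
    obtain ⟨s', hs'⟩ := ih L
    exact ⟨.cons h1 h3 L₀ s', fun n Y => hs' n _⟩

theorem relu_sub_relu_neg (x : ℝ) : relu x - relu (-x) = x := by
  unfold relu
  rcases le_total x 0 with h | h
  · rw [max_eq_right h, max_eq_left (by linarith)]; ring
  · rw [max_eq_left h, max_eq_right (by linarith)]; ring

theorem relu_relu (x : ℝ) : relu (relu x) = relu x := by
  simp [relu]

/-- On a finite set, every function agrees with a combination of shifted ReLUs and constants. -/
theorem exists_relu_interpolation (f : ℝ → ℝ) (s : Finset ℝ) :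
    ∃ g ∈ Submodule.span ℝ
      (insert (fun _ : ℝ => (1 : ℝ)) (Set.range fun (t : ℝ) (x : ℝ) => relu (x - t))),
      ∀ x ∈ s, g x = f x := by
  induction s using Finset.induction_on_max with
  | empty => exact ⟨0, Submodule.zero_mem _, by simp⟩
  | insert m s hm ih =>
    obtain ⟨g, hg, hgs⟩ := ih
    -- A hinge at `t` vanishes on all earlier points, so its slope can correct the value at the new
    -- maximum `m` alone.
    obtain ⟨t, htm, hts⟩ : ∃ t < m, ∀ x ∈ s, x ≤ t := by
      rcases s.eq_empty_or_nonempty with rfl | hne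
      · exact ⟨m - 1, by linarith, by simp⟩
      · exact ⟨s.max' hne, hm _ (s.max'_mem hne), fun x hx => s.le_max' x hx⟩
    refine ⟨g + ((f m - g m) / (m - t)) • fun x => relu (x - t),
      Submodule.add_mem _ hg (Submodule.smul_mem _ _ (Submodule.subset_span (.inr ⟨t, rfl⟩))), ?_⟩
    intro x hx
    rcases Finset.mem_insert.1 hx with rfl | hx
    · have h : relu (x - t) = x - t := max_eq_left (by linarith)
      have h0 : x - t ≠ 0 := by linarith
      simp only [Pi.add_apply, Pi.smul_apply, smul_eq_mul, h]
      field_simp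
      ring
    · have h : relu (x - t) = 0 := max_eq_right (by linarith [hts x hx])
      simp [h, hgs x hx]

/-! ### Definable tensors and their closure properties -/

section Definability

variable {ι : Type} {d : ℕ} {G : ι → AttrGraph d}

/-- The span of the output channels of a stacking after the ReLU, on a family of graphs. -/
def IGNStack.channelSpan (G : ι → AttrGraph d) {e : ℕ} (s : IGNStack 2 (d + 1) 3 e) :
    Submodule ℝ (∀ i, (Fin 3 → Fin (G i).n) → ℝ) :=
  Submodule.span ℝ (Set.range fun c i a => relu (s.eval (G i).tensor a c))

/-- The input channels as tensors of order three. -/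
noncomputable def inputChannel (G : ι → AttrGraph d) (c : Fin (d + 1)) : ∀ i, (Fin 3 → Fin (G i).n) → ℝ :=
  fun i a => (G i).tensor ![a 0, a 1] c

/-- A tensor of order three is definable on a family of graphs if each stacking that retains the
input can be continued, retaining what it computes, to one that also computes the tensor. -/
def IGNDefinable (G : ι → AttrGraph d)
    (f : ∀ i, Fin (G i).n → Fin (G i).n → Fin (G i).n → ℝ) : Prop :=
  ∀ (e : ℕ) (s : IGNStack 2 (d + 1) 3 e), (∀ c, inputChannel G c ∈ s.channelSpan G) →
    ∃ (e' : ℕ) (s' : IGNStack 2 (d + 1) 3 e'), s.channelSpan G ≤ s'.channelSpan G ∧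
      (fun i b => f i (b 0) (b 1) (b 2)) ∈ s'.channelSpan G

-- The new layer copies the old channels and adds one. The copies survive the extra ReLU because
-- they are already nonnegative. The combination `v` expressing `T` in the old channels is absorbed
-- into the weights of the new channel.
open Classical in
theorem IGNStack.exists_relu_layer {e : ℕ} (s : IGNStack 2 (d + 1) 3 e)
    {T : ∀ i, (Fin 3 → Fin (G i).n) → ℝ} (hT : T ∈ s.channelSpan G)
    (w : Setoid (Fin 3 ⊕ Fin 3) → ℝ) (β : Setoid (Fin 3) → ℝ) :
    ∃ s' : IGNStack 2 (d + 1) 3 (e + 1), s.channelSpan G ≤ s'.channelSpan G ∧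
      (fun i b => relu ((∑ a, w (Setoid.ker (Sum.elim a b)) * T i a) + β (Setoid.ker b)))
        ∈ s'.channelSpan G := by
  obtain ⟨v, hv⟩ := (Submodule.mem_span_range_iff_exists_fun ℝ).1 hT
  let L : EquivLayer 3 e 3 (e + 1) :=
    { weight := fun p => Matrix.of fun r c => Fin.lastCases (motive := fun _ => ℝ) (w p * v c)
        (fun r => if (∀ j, p.r (.inl j) (.inr j)) ∧ r = c then 1 else 0) r
      bias := fun p => Fin.snoc (α := fun _ => ℝ) (fun _ => 0) (β p) }
  have hker : ∀ {n : ℕ} (a b : Fin 3 → Fin n),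
      (∀ j, (Setoid.ker (Sum.elim a b)).r (.inl j) (.inr j)) ↔ a = b := fun a b =>
    ⟨fun h => funext h, fun h j => congrFun h j⟩
  have h₁ : ∀ {n : ℕ} (Z : Tensor n 3 e) (b : Fin 3 → Fin n) (r : Fin e),
      L.eval Z b r.castSucc = Z b r := by
    intro n Z b r
    simp only [EquivLayer.eval, L, Pi.add_apply, Finset.sum_apply, Matrix.mulVec, dotProduct,
      Matrix.of_apply, Fin.lastCases_castSucc, Fin.snoc_castSucc, hker]
    simp [ite_and]
  have h₂ : ∀ {n : ℕ} (Z : Tensor n 3 e) (b : Fin 3 → Fin n),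
      L.eval Z b (Fin.last e) = (∑ a, w (Setoid.ker (Sum.elim a b)) * ∑ c, v c * Z a c)
        + β (Setoid.ker b) := by
    intro n Z b
    simp only [EquivLayer.eval, L, Pi.add_apply, Finset.sum_apply, Matrix.mulVec, dotProduct,
      Matrix.of_apply, Fin.lastCases_last, Fin.snoc_last, Finset.mul_sum, mul_assoc]
  obtain ⟨s', hs'⟩ := s.exists_snoc L
  refine ⟨s', Submodule.span_le.2 ?_, ?_⟩
  · rintro _ ⟨c, rfl⟩
    refine Submodule.subset_span ⟨c.castSucc, ?_⟩
    funext i a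
    simp only [hs', h₁, relu_relu]
  · refine Submodule.subset_span ⟨Fin.last e, ?_⟩
    funext i b
    simp only [hs', h₂, ← hv]
    simp

/-- Channels are only seen through a ReLU, so the positive and negative parts of `g` are computed by
two successive layers and subtracted within the span. -/
theorem IGNDefinable.linear {f g : ∀ i, Fin (G i).n → Fin (G i).n → Fin (G i).n → ℝ}
    (hf : IGNDefinable G f) (w : Setoid (Fin 3 ⊕ Fin 3) → ℝ) (β : Setoid (Fin 3) → ℝ)
    (h : ∀ i (b : Fin 3 → Fin (G i).n), g i (b 0) (b 1) (b 2) =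
      (∑ a, w (Setoid.ker (Sum.elim a b)) * f i (a 0) (a 1) (a 2)) + β (Setoid.ker b)) :
    IGNDefinable G g := by
  intro e s hs
  obtain ⟨e₁, s₁, h₁, hf₁⟩ := hf e s hs
  obtain ⟨s₂, h₂, hp⟩ := s₁.exists_relu_layer hf₁ w β
  obtain ⟨s₃, h₃, hn⟩ := s₂.exists_relu_layer (h₂ hf₁) (fun p => - w p) (fun p => - β p)
  refine ⟨_, s₃, h₁.trans (h₂.trans h₃), ?_⟩
  convert Submodule.sub_mem _ (h₃ hp) hn using 1
  funext i b
  have hneg : ∑ a, -w (Setoid.ker (Sum.elim a b)) * f i (a 0) (a 1) (a 2) + -β (Setoid.ker b) =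
      -(∑ a, w (Setoid.ker (Sum.elim a b)) * f i (a 0) (a 1) (a 2) + β (Setoid.ker b)) := by
    simp only [neg_mul, Finset.sum_neg_distrib, neg_add]
  rw [h, Pi.sub_apply, Pi.sub_apply, hneg, relu_sub_relu_neg]

theorem IGNDefinable.relu {f : ∀ i, Fin (G i).n → Fin (G i).n → Fin (G i).n → ℝ}
    (hf : IGNDefinable G f) : IGNDefinable G fun i x y z => relu (f i x y z) := by
  classical
  intro e s hs
  obtain ⟨e₁, s₁, h₁, hf₁⟩ := hf e s hs
  obtain ⟨s₂, h₂, hp⟩ := s₁.exists_relu_layer hf₁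
    -- This weight selects `a = b`: the linear part is the identity.
    (fun p => if ∀ j, p.r (.inl j) (.inr j) then 1 else 0) (fun _ => 0)
  refine ⟨_, s₂, h₁.trans h₂, ?_⟩
  convert hp using 3 with i b
  have hker : ∀ a, (∀ j, (Setoid.ker (Sum.elim a b)).r (.inl j) (.inr j)) ↔ a = b := fun a =>
    ⟨fun h => funext h, fun h j => congrFun h j⟩
  simp only [hker]
  simp

theorem IGNDefinable.zero : IGNDefinable G fun _ _ _ _ => 0 :=
  fun e s _ => ⟨e, s, le_rfl, Submodule.zero_mem _⟩

theorem IGNDefinable.bias (β : Setoid (Fin 3) → ℝ) :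
    IGNDefinable G fun _ x y z => β (Setoid.ker ![x, y, z]) :=
  IGNDefinable.zero.linear 0 β fun i b => by
    have : ![b 0, b 1, b 2] = b := by ext j; fin_cases j <;> rfl
    simp [this]

theorem IGNDefinable.const (r : ℝ) : IGNDefinable G fun _ _ _ _ => r :=
  IGNDefinable.bias fun _ => r

/-- The stacking for `g` is built on top of the one for `f`; this is where definability needs to
start from an arbitrary stacking and retain its span. -/
theorem IGNDefinable.add {f g : ∀ i, Fin (G i).n → Fin (G i).n → Fin (G i).n → ℝ}
    (hf : IGNDefinable G f) (hg : IGNDefinable G g) :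
    IGNDefinable G fun i x y z => f i x y z + g i x y z := by
  intro e s hs
  obtain ⟨e₁, s₁, h₁, hf₁⟩ := hf e s hs
  obtain ⟨e₂, s₂, h₂, hg₂⟩ := hg e₁ s₁ fun c => h₁ (hs c)
  exact ⟨e₂, s₂, h₁.trans h₂, Submodule.add_mem _ (h₂ hf₁) hg₂⟩

theorem IGNDefinable.const_mul {f : ∀ i, Fin (G i).n → Fin (G i).n → Fin (G i).n → ℝ} (r : ℝ)
    (hf : IGNDefinable G f) : IGNDefinable G fun i x y z => r * f i x y z := by
  intro e s hs
  obtain ⟨e₁, s₁, h₁, hf₁⟩ := hf e s hs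
  exact ⟨e₁, s₁, h₁, Submodule.smul_mem _ r hf₁⟩

theorem IGNDefinable.finset_sum {κ : Type*} (s : Finset κ)
    {f : κ → ∀ i, Fin (G i).n → Fin (G i).n → Fin (G i).n → ℝ}
    (hf : ∀ j, IGNDefinable G (f j)) :
    IGNDefinable G fun i x y z => ∑ j ∈ s, f j i x y z := by
  classical
  induction s using Finset.induction_on with
  | empty => simpa using IGNDefinable.zero
  | insert j s hj ih => simpa [Finset.sum_insert hj] using (hf j).add ih

/-- Over finitely many graphs `f` has finitely many values, and `φ` matters only there. -/
theorem IGNDefinable.comp [Finite ι] {f : ∀ i, Fin (G i).n → Fin (G i).n → Fin (G i).n → ℝ}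
    (hf : IGNDefinable G f) (φ : ℝ → ℝ) : IGNDefinable G fun i x y z => φ (f i x y z) := by
  have hfin : (Set.range fun p : Σ i, Fin (G i).n × Fin (G i).n × Fin (G i).n =>
      f p.1 p.2.1 p.2.2.1 p.2.2.2).Finite := Set.finite_range _
  obtain ⟨g, hg, hgs⟩ := exists_relu_interpolation φ hfin.toFinset
  have key : ∀ g ∈ Submodule.span ℝ
      (insert (fun _ : ℝ => (1 : ℝ)) (Set.range fun (t : ℝ) (x : ℝ) => _root_.relu (x - t))),
      IGNDefinable G fun i x y z => g (f i x y z) := by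
    intro g hg
    induction hg using Submodule.span_induction with
    | mem g hg =>
      rcases hg with rfl | ⟨t, rfl⟩
      · exact .const 1
      · simpa only [sub_eq_add_neg] using (hf.add (.const (-t))).relu
    | zero => exact .zero
    | add g g' _ _ h h' => exact h.add h'
    | smul r g _ h => exact h.const_mul r
  have h : (fun i x y z => φ (f i x y z)) = fun i x y z => g (f i x y z) := by
    funext i x y z
    exact (hgs _ (hfin.mem_toFinset.2 ⟨⟨i, x, y, z⟩, rfl⟩)).symm
  rw [h]
  exact key g hg

/-- Polarization: `f * g = ((f + g) ^ 2 - (f ^ 2 + g ^ 2)) / 2`. -/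
theorem IGNDefinable.mul [Finite ι] {f g : ∀ i, Fin (G i).n → Fin (G i).n → Fin (G i).n → ℝ}
    (hf : IGNDefinable G f) (hg : IGNDefinable G g) :
    IGNDefinable G fun i x y z => f i x y z * g i x y z := by
  have h := (((hf.add hg).comp (· ^ 2)).add (((hf.comp (· ^ 2)).add (hg.comp (· ^ 2))).const_mul
    (-1))).const_mul (1 / 2)
  convert h using 5
  ring

/-- The weight is the indicator of `a = b ∘ τ`, so a single summand remains. As `τ` need not be
injective, this covers diagonals as well as permutations. -/
theorem IGNDefinable.reindex {f : ∀ i, Fin (G i).n → Fin (G i).n → Fin (G i).n → ℝ}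
    (hf : IGNDefinable G f) (τ : Fin 3 → Fin 3) :
    IGNDefinable G fun i x y z =>
      f i (![x, y, z] (τ 0)) (![x, y, z] (τ 1)) (![x, y, z] (τ 2)) := by
  classical
  refine hf.linear (fun p => if ∀ j, p.r (.inl j) (.inr (τ j)) then 1 else 0) 0 fun i b => ?_
  have hb : ![b 0, b 1, b 2] = b := by ext j; fin_cases j <;> rfl
  have hker : ∀ a, (∀ j, (Setoid.ker (Sum.elim a b)).r (.inl j) (.inr (τ j))) ↔ a = b ∘ τ :=
    fun a => ⟨fun h => funext h, fun h j => congrFun h j⟩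
  simp only [hker, hb]
  simp

theorem IGNDefinable.sum {f : ∀ i, Fin (G i).n → Fin (G i).n → Fin (G i).n → ℝ}
    (hf : IGNDefinable G f) : IGNDefinable G fun i x y _ => ∑ z, f i x y z := by
  classical
  refine hf.linear
    -- The pattern ties the first two input indices to the output and leaves the third free to be
    -- summed.
    (fun p => if p.r (.inl 0) (.inr 0) ∧ p.r (.inl 1) (.inr 1) then 1 else 0) 0 fun i b => ?_
  have hker : ∀ a : Fin 3 → Fin (G i).n, ((Setoid.ker (Sum.elim a b)).r (.inl 0) (.inr 0) ∧
      (Setoid.ker (Sum.elim a b)).r (.inl 1) (.inr 1)) ↔ (a 0 = b 0 ∧ a 1 = b 1) :=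
    fun a => Iff.rfl
  simp only [hker, ite_mul, one_mul, zero_mul, Pi.zero_apply, add_zero, ← Finset.sum_filter]
  refine Finset.sum_bij' (fun z _ => ![b 0, b 1, z]) (fun a _ => a 2) ?_ ?_ ?_ ?_ ?_
  · simp
  · simp
  · simp
  · intro a ha
    simp only [Finset.mem_filter, Finset.mem_univ, true_and] at ha
    ext j
    fin_cases j <;> simp [ha]
  · simp

/-! ### Input channels and reading off a separating 3-IGN -/

theorem IGNDefinable.inputChannel (c : Fin (d + 1)) :
    IGNDefinable G fun i x y _ => (G i).tensor ![x, y] c :=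
  fun e s hs => ⟨e, s, le_rfl, hs c⟩

-- Features may be negative, so each input channel is stored with both signs, and the difference
-- recovers it after the ReLU.
open Classical in
theorem exists_stack_inputChannel (G : ι → AttrGraph d) :
    ∃ (e : ℕ) (s : IGNStack 2 (d + 1) 3 e), ∀ c, inputChannel G c ∈ s.channelSpan G := by
  let L : EquivLayer 2 (d + 1) 3 ((d + 1) + (d + 1)) :=
    { weight := fun p => Matrix.of fun r c =>
        if p.r (.inl 0) (.inr 0) ∧ p.r (.inl 1) (.inr 1) then
          Fin.append (fun r => if r = c then (1 : ℝ) else 0) (fun r => if r = c then -1 else 0) r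
        else 0
      bias := fun _ => 0 }
  have hker : ∀ {n : ℕ} (a : Fin 2 → Fin n) (b : Fin 3 → Fin n),
      ((Setoid.ker (Sum.elim a b)).r (.inl 0) (.inr 0) ∧
        (Setoid.ker (Sum.elim a b)).r (.inl 1) (.inr 1)) ↔ a = ![b 0, b 1] := fun a b =>
    ⟨fun h => by ext j; fin_cases j; exacts [congrArg Fin.val h.1, congrArg Fin.val h.2],
      fun h => by subst h; exact ⟨rfl, rfl⟩⟩
  have h₁ : ∀ {n : ℕ} (Y : Tensor n 2 (d + 1)) (b : Fin 3 → Fin n) (c : Fin (d + 1)),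
      L.eval Y b (Fin.castAdd _ c) = Y ![b 0, b 1] c := by
    intro n Y b c
    simp only [EquivLayer.eval, L, Pi.add_apply, Finset.sum_apply, Matrix.mulVec, dotProduct,
      Matrix.of_apply, Fin.append_left, hker]
    simp [ite_mul, Finset.sum_ite_eq]
  have h₂ : ∀ {n : ℕ} (Y : Tensor n 2 (d + 1)) (b : Fin 3 → Fin n) (c : Fin (d + 1)),
      L.eval Y b (Fin.natAdd _ c) = - Y ![b 0, b 1] c := by
    intro n Y b c
    simp only [EquivLayer.eval, L, Pi.add_apply, Finset.sum_apply, Matrix.mulVec, dotProduct,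
      Matrix.of_apply, Fin.append_right, hker]
    simp [ite_mul, Finset.sum_ite_eq]
  refine ⟨_, .single (by norm_num) le_rfl L, fun c => ?_⟩
  have h := Submodule.sub_mem (IGNStack.channelSpan G (.single (by norm_num) le_rfl L))
    (Submodule.subset_span ⟨Fin.castAdd _ c, rfl⟩) (Submodule.subset_span ⟨Fin.natAdd _ c, rfl⟩)
  convert h using 1
  funext i b
  simp only [Pi.sub_apply, IGNStack.eval, h₁, h₂, relu_sub_relu_neg]
  rfl

/-- A definable tensor whose entries have different sums on two graphs yields a 3-IGN that
separates them. -/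
theorem IGNDefinable.exists_separating
    {f : ∀ i, Fin (G i).n → Fin (G i).n → Fin (G i).n → ℝ} (hf : IGNDefinable G f) {i j : ι}
    (hij : ∑ a : Fin 3 → Fin (G i).n, f i (a 0) (a 1) (a 2) ≠
      ∑ a : Fin 3 → Fin (G j).n, f j (a 0) (a 1) (a 2)) {out : ℕ} (o : Fin out) :
    ∃ M : IGN3 d out, M.eval (G i) ≠ M.eval (G j) := by
  classical
  obtain ⟨e₀, s₀, h₀⟩ := exists_stack_inputChannel G
  obtain ⟨e, s, -, hs⟩ := hf e₀ s₀ h₀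
  obtain ⟨v, hv⟩ := (Submodule.mem_span_range_iff_exists_fun ℝ).1 hs
  -- A stacking ends without a ReLU, whereas the span refers to channels after it; an appended
  -- identity layer inserts that ReLU before pooling.
  let I : EquivLayer 3 e 3 e :=
    { weight := fun p => if ∀ j, p.r (.inl j) (.inr j) then 1 else 0
      bias := fun _ => 0 }
  obtain ⟨s', hs'⟩ := s.exists_snoc I
  have hI : ∀ {n : ℕ} (Z : Tensor n 3 e), I.eval Z = Z := by
    intro n Z
    funext b
    have hker : ∀ a, (∀ j, (Setoid.ker (Sum.elim a b)).r (.inl j) (.inr j)) ↔ a = b := fun a =>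
      ⟨fun h => funext h, fun h j => congrFun h j⟩
    have : ∀ a, (if a = b then (1 : Matrix (Fin e) (Fin e) ℝ) else 0) *ᵥ Z a =
        if a = b then Z a else 0 := fun a => by split_ifs <;> simp
    simp only [EquivLayer.eval, I, hker, this]
    simp
  let M : IGN3 d out :=
    { k := 3, e := e, f := 1, stack := s'
      -- The same weight for every pattern sums the combination `v` over all entries.
      pool := { weight := fun _ => Matrix.of fun _ c => v c, bias := fun _ => 0 }
      mlp := .affine (Matrix.of fun _ _ => 1) 0 }
  have hM : ∀ i, M.eval (G i) o = ∑ a : Fin 3 → Fin (G i).n, f i (a 0) (a 1) (a 2) := by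
    intro i
    have hv' : ∀ a, f i (a 0) (a 1) (a 2) = ∑ c, v c * _root_.relu (s.eval (G i).tensor a c) := by
      intro a
      have := congrFun (congrFun hv i) a
      simpa using this.symm
    simp only [IGN3.eval, M, MLP.eval, hs', hI]
    simp only [EquivLayer.eval, Pi.add_apply, Matrix.mulVec,
      dotProduct, Matrix.of_apply, Finset.sum_apply, hv']
    simp
  exact ⟨M, fun h => hij (by rw [← hM, ← hM, h])⟩

open Classical in
/-- A ternary relation on nodes is definable if its indicator is. -/
def IGNDefinableRel (G : ι → AttrGraph d)
    (P : ∀ i, Fin (G i).n → Fin (G i).n → Fin (G i).n → Prop) : Prop :=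
  IGNDefinable G fun i x y z => if P i x y z then 1 else 0

/-! ### Definable relations: distance balls and policies -/

section Relations

variable {P Q : ∀ i, Fin (G i).n → Fin (G i).n → Fin (G i).n → Prop}

theorem IGNDefinableRel.congr (hP : IGNDefinableRel G P)
    (h : ∀ i x y z, Q i x y z ↔ P i x y z) : IGNDefinableRel G Q := by
  have : Q = P := by
    funext i x y z
    exact propext (h i x y z)
  rwa [this]

theorem IGNDefinableRel.true : IGNDefinableRel G fun _ _ _ _ => True := by
  simpa [IGNDefinableRel] using IGNDefinable.const 1

theorem IGNDefinableRel.reindex (hP : IGNDefinableRel G P) (τ : Fin 3 → Fin 3) :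
    IGNDefinableRel G fun i x y z =>
      P i (![x, y, z] (τ 0)) (![x, y, z] (τ 1)) (![x, y, z] (τ 2)) :=
  IGNDefinable.reindex (f := fun i x y z => open Classical in if P i x y z then 1 else 0) hP τ

theorem IGNDefinableRel.not (hP : IGNDefinableRel G P) :
    IGNDefinableRel G fun i x y z => ¬ P i x y z := by
  unfold IGNDefinableRel
  convert (IGNDefinable.const 1).add (IGNDefinable.const_mul (-1) hP) using 5 with i x y z
  by_cases h : P i x y z <;> simp [h]

/-- The pattern of the output index records this equality, so a bias suffices. -/
theorem IGNDefinableRel.eq : IGNDefinableRel G fun _ x y _ => x = y := by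
  classical
  unfold IGNDefinableRel
  convert IGNDefinable.bias (G := G) fun p => if p.r 0 1 then 1 else 0 using 5 with i x y z
  have h : (Setoid.ker ![x, y, z]).r 0 1 ↔ x = y := Iff.rfl
  by_cases hxy : x = y <;> simp only [h, hxy, if_true, if_false]

theorem IGNDefinableRel.adj : IGNDefinableRel G fun i x y _ => (G i).graph.Adj x y := by
  classical
  unfold IGNDefinableRel
  convert IGNDefinable.inputChannel (G := G) 0 using 5 with i x y z
  simp [AttrGraph.tensor]

theorem mem_hopBall_succ {n : ℕ} (H : SimpleGraph (Fin n)) (h : ℕ) (v w : Fin n) :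
    w ∈ hopBall H (h + 1) v ↔ v = w ∨ ∃ u, H.Adj v u ∧ w ∈ hopBall H h u := by
  constructor
  · rintro ⟨p, hp⟩
    cases p with
    | nil => exact .inl rfl
    | cons huv p => exact .inr ⟨_, huv, p, by simpa using hp⟩
  · rintro (rfl | ⟨u, hvu, p, hp⟩)
    · exact ⟨.nil, by simp⟩
    · exact ⟨.cons hvu p, by simpa using hp⟩

variable [Finite ι]

theorem IGNDefinableRel.and (hP : IGNDefinableRel G P) (hQ : IGNDefinableRel G Q) :
    IGNDefinableRel G fun i x y z => P i x y z ∧ Q i x y z := by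
  unfold IGNDefinableRel
  convert IGNDefinable.mul hP hQ using 5 with i x y z
  by_cases h : P i x y z <;> by_cases h' : Q i x y z <;> simp [h, h']

theorem IGNDefinableRel.or (hP : IGNDefinableRel G P) (hQ : IGNDefinableRel G Q) :
    IGNDefinableRel G fun i x y z => P i x y z ∨ Q i x y z :=
  (hP.not.and hQ.not).not.congr fun i x y z => by tauto

/-- The sum over `z` counts the witnesses; a step function then tests whether the count is nonzero.
-/
theorem IGNDefinableRel.exists (hP : IGNDefinableRel G P) :
    IGNDefinableRel G fun i x y _ => ∃ z, P i x y z := by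
  classical
  unfold IGNDefinableRel
  convert (IGNDefinable.sum hP).comp fun t => if t = 0 then 0 else 1 using 5 with i x y z
  simp only [Finset.sum_boole, Nat.cast_eq_zero, Finset.card_eq_zero,
    Finset.filter_eq_empty_iff, Finset.mem_univ, true_implies]
  split_ifs <;> simp_all

theorem IGNDefinable.ite {f g : ∀ i, Fin (G i).n → Fin (G i).n → Fin (G i).n → ℝ}
    (hP : IGNDefinableRel G P) (hf : IGNDefinable G f) (hg : IGNDefinable G g)
    [∀ i x y z, Decidable (P i x y z)] :
    IGNDefinable G fun i x y z => if P i x y z then f i x y z else g i x y z := by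
  convert (IGNDefinable.mul hP hf).add (IGNDefinable.mul hP.not hg) using 5 with i x y z
  by_cases h : P i x y z <;> simp [h]

theorem IGNDefinableRel.hopBall (h : ℕ) :
    IGNDefinableRel G fun i x y _ => y ∈ hopBall (G i).graph h x := by
  induction h with
  | zero =>
    refine IGNDefinableRel.eq.congr fun i x y z => ⟨?_, ?_⟩
    · rintro ⟨p, hp⟩
      exact p.eq_of_length_eq_zero (by omega)
    · rintro rfl
      exact ⟨.nil, by simp⟩
  | succ h ih =>
    -- The first step of a walk leads to the quantified third node. A list such as `![0, 2, 2]` says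
    -- which variable enters each slot; entries for ignored slots are arbitrary.
    exact (IGNDefinableRel.eq.or
      ((IGNDefinableRel.adj.reindex ![0, 2, 2]).and (ih.reindex ![2, 1, 1])).exists).congr
        fun i x y z => mem_hopBall_succ _ _ _ _

theorem IGNDefinableRel.policy_mem_verts (π : Policy) :
    IGNDefinableRel G fun i x y _ => y ∈ (π.subgraph (G i).graph x).verts := by
  cases π with
  | nodeDeletion =>
    exact IGNDefinableRel.eq.not.congr fun i x y z => by simp [Policy.subgraph, eq_comm]
  | nodeMarking => exact IGNDefinableRel.true.congr fun i x y z => by simp [Policy.subgraph]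
  | ego h hpos => exact (IGNDefinableRel.hopBall h).congr fun i x y z => Iff.rfl
  | egoMarked h hpos => exact (IGNDefinableRel.hopBall h).congr fun i x y z => Iff.rfl

theorem Policy.subgraph_adj {n : ℕ} (π : Policy) (H : SimpleGraph (Fin n)) (v i j : Fin n) :
    (π.subgraph H v).Adj i j ↔
      i ∈ (π.subgraph H v).verts ∧ j ∈ (π.subgraph H v).verts ∧ H.Adj i j := by
  cases π <;> simp [Policy.subgraph]

/-- Every policy selects induced subgraphs, so membership of both endpoints and adjacency in the
original graph decide adjacency. -/
theorem IGNDefinableRel.policy_adj (π : Policy) :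
    IGNDefinableRel G fun i x y z => (π.subgraph (G i).graph x).Adj y z :=
  ((IGNDefinableRel.policy_mem_verts π).and
    (((IGNDefinableRel.policy_mem_verts π).reindex ![0, 2, 1]).and
      (IGNDefinableRel.adj.reindex ![1, 2, 0]))).congr fun _ _ _ _ => π.subgraph_adj _ _ _ _

theorem IGNDefinableRel.policy_mem_nodes (π : Policy) (c : NodeConvention) :
    IGNDefinableRel G fun i x y _ => y ∈ c.nodes (π.subgraph (G i).graph x) := by
  cases c with
  | padded => exact IGNDefinableRel.true.congr fun i x y z => by simp [NodeConvention.nodes]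
  | removed =>
    exact (IGNDefinableRel.policy_mem_verts π).congr fun i x y z => by simp [NodeConvention.nodes]

end Relations

/-- Definability of all channels of a vector-valued tensor. -/
def IGNDefinableVec (G : ι → AttrGraph d) {e : ℕ}
    (f : ∀ i, Fin (G i).n → Fin (G i).n → Fin (G i).n → Fin e → ℝ) : Prop :=
  ∀ c, IGNDefinable G fun i x y z => f i x y z c

/-! ### Vector-valued tensors and MLPs -/

namespace IGNDefinableVec

variable {e e' : ℕ} {f g : ∀ i, Fin (G i).n → Fin (G i).n → Fin (G i).n → Fin e → ℝ}

theorem reindex (hf : IGNDefinableVec G f) (τ : Fin 3 → Fin 3) :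
    IGNDefinableVec G fun i x y z =>
      f i (![x, y, z] (τ 0)) (![x, y, z] (τ 1)) (![x, y, z] (τ 2)) :=
  fun c => (hf c).reindex τ

theorem zero : IGNDefinableVec G (fun _ _ _ _ => (0 : Fin e → ℝ)) :=
  fun _ => IGNDefinable.zero

theorem add (hf : IGNDefinableVec G f) (hg : IGNDefinableVec G g) :
    IGNDefinableVec G fun i x y z => f i x y z + g i x y z :=
  fun c => (hf c).add (hg c)

theorem mulVec (hf : IGNDefinableVec G f) (W : Matrix (Fin e') (Fin e) ℝ) :
    IGNDefinableVec G fun i x y z => W *ᵥ f i x y z :=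
  fun c => IGNDefinable.finset_sum Finset.univ fun c' => (hf c').const_mul (W c c')

theorem append {g : ∀ i, Fin (G i).n → Fin (G i).n → Fin (G i).n → Fin e' → ℝ}
    (hf : IGNDefinableVec G f) (hg : IGNDefinableVec G g) :
    IGNDefinableVec G fun i x y z => Fin.append (f i x y z) (g i x y z) := by
  intro c
  induction c using Fin.addCases with
  | left c => simpa using hf c
  | right c => simpa using hg c

theorem sum (hf : IGNDefinableVec G f) : IGNDefinableVec G fun i x y _ => ∑ z, f i x y z := by
  intro c
  simpa using (hf c).sum

variable [Finite ι]

theorem comp (hf : IGNDefinableVec G f) (σ : ℝ → ℝ) :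
    IGNDefinableVec G fun i x y z c => σ (f i x y z c) :=
  fun c => (hf c).comp σ

theorem ite {P : ∀ i, Fin (G i).n → Fin (G i).n → Fin (G i).n → Prop}
    (hP : IGNDefinableRel G P) (hf : IGNDefinableVec G f) (hg : IGNDefinableVec G g)
    [∀ i x y z, Decidable (P i x y z)] :
    IGNDefinableVec G fun i x y z => if P i x y z then f i x y z else g i x y z := by
  intro c
  convert IGNDefinable.ite hP (hf c) (hg c) using 5 with i x y z
  by_cases h : P i x y z <;> simp [h]

theorem sum_filter {P : ∀ i, Fin (G i).n → Fin (G i).n → Fin (G i).n → Prop}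
    (hP : IGNDefinableRel G P) (hf : IGNDefinableVec G f) [∀ i x y z, Decidable (P i x y z)] :
    IGNDefinableVec G fun i x y _ => ∑ z with P i x y z, f i x y z := by
  simp only [Finset.sum_filter]
  exact (ite hP hf zero).sum

theorem mlp (hf : IGNDefinableVec G f) (σ : ℝ → ℝ) (M : MLP e e') :
    IGNDefinableVec G fun i x y z => M.eval σ (f i x y z) := by
  induction M with
  | affine W β => exact (hf.mulVec W).add fun c => IGNDefinable.const (β c)
  | hidden W β rest ih =>
    exact ih (((hf.mulVec W).add fun c => IGNDefinable.const (β c)).comp σ)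

end IGNDefinableVec

/-- An invariant of stacks of layers, on a family of inputs. -/
theorem Stack.run_induction {κ : Type} {L : ℕ → ℕ → Type} {F : κ → ℕ → Type}
    (step : ∀ i (a b : ℕ), L a b → F i a → F i b) (P : ∀ a, (∀ i, F i a) → Prop)
    (hstep : ∀ (a b : ℕ) (l : L a b) (x : ∀ i, F i a), P a x →
      P b fun i => step i a b l (x i))
    {a b : ℕ} (S : Stack L a b) (x : ∀ i, F i a) (hx : P a x) :
    P b fun i => S.run (step i) (x i) := by
  induction S with
  | nil a => exact hx
  | cons l rest ih => exact ih _ (hstep _ _ l x hx)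

/-! ### Simulation of the layers and readouts -/

section Layers

variable {a b : ℕ}

theorem IGNDefinableVec.feat : IGNDefinableVec G fun i k _ _ => (G i).feat k := by
  intro c
  simpa [AttrGraph.tensor] using
    (IGNDefinable.inputChannel (G := G) c.succ).reindex ![0, 0, 0]

theorem IGNDefinableVec.sum_nodes {x : ∀ i, Fin (G i).n → Fin a → ℝ}
    (hx : IGNDefinableVec G fun i k _ _ => x i k) : IGNDefinableVec G fun i _ _ _ => ∑ k, x i k :=
  (hx.reindex ![2, 0, 0]).sum

variable [Finite ι] (σ : ℝ → ℝ)

/-- Root and node occupy two indices and the neighbour takes the third, so order three is exactly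
what this construction uses. -/
theorem IGNDefinableVec.neighborSum {adj : ∀ i, Fin (G i).n → Fin (G i).n → Fin (G i).n → Prop}
    (hadj : IGNDefinableRel G adj) {x : ∀ i, BagFeat (G i).n a}
    (hx : IGNDefinableVec G fun i k v _ => x i k v) :
    IGNDefinableVec G fun i k v _ => neighborSum (adj i k) (x i k) v := by
  classical
  exact IGNDefinableVec.sum_filter hadj (hx.reindex ![0, 2, 1])

theorem IGNDefinableVec.morris {adj : ∀ i, Fin (G i).n → Fin (G i).n → Fin (G i).n → Prop}
    (hadj : IGNDefinableRel G adj) {x : ∀ i, BagFeat (G i).n a}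
    (hx : IGNDefinableVec G fun i k v _ => x i k v) (L : MorrisLayer a b) :
    IGNDefinableVec G fun i k v _ => L.eval σ (adj i k) a b (x i k) v :=
  ((hx.mulVec L.W₁).add ((IGNDefinableVec.neighborSum hadj hx).mulVec L.W₂)).comp σ

variable {H : ∀ i, Fin (G i).n → (G i).graph.Subgraph} {V : ∀ i, Fin (G i).n → Finset (Fin (G i).n)}

theorem IGNDefinableVec.morrisStack (hH : IGNDefinableRel G fun i k v w => (H i k).Adj v w)
    {x : ∀ i, BagFeat (G i).n a}
    (hx : IGNDefinableVec G fun i k v _ => x i k v) (S : Stack MorrisLayer a b) :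
    IGNDefinableVec G fun i k v _ =>
      S.run (F := BagFeat (G i).n) (MorrisLayer.evalBag σ (H i)) (x i) k v :=
  S.run_induction (F := fun i => BagFeat (G i).n) (fun i => MorrisLayer.evalBag σ (H i))
    (fun _ x => IGNDefinableVec G fun i k v _ => x i k v)
    (fun _ _ L _ hx => IGNDefinableVec.morris σ hH hx L) x hx

theorem IGNDefinableVec.nodeSum (hV : IGNDefinableRel G fun i k v _ => v ∈ V i k)
    {x : ∀ i, BagFeat (G i).n a} (hx : IGNDefinableVec G fun i k v _ => x i k v) :
    IGNDefinableVec G fun i k _ _ => nodeSum (V i) (x i) k := by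
  have h := IGNDefinableVec.sum_filter (hV.reindex ![0, 2, 1]) (hx.reindex ![0, 2, 1])
  convert h using 5 with i k
  exact Finset.sum_congr (Finset.ext fun v =>
    ⟨fun hv => Finset.mem_filter.2 ⟨Finset.mem_univ v, hv⟩, fun hv => (Finset.mem_filter.1 hv).2⟩)
      fun _ _ => rfl

theorem IGNDefinableVec.crossSum (hV : IGNDefinableRel G fun i k v _ => v ∈ V i k)
    {x : ∀ i, BagFeat (G i).n a} (hx : IGNDefinableVec G fun i k v _ => x i k v) :
    IGNDefinableVec G fun i v _ _ => crossSum (V i) (x i) v :=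
  IGNDefinableVec.sum_filter (hV.reindex ![2, 0, 1]) (hx.reindex ![2, 0, 1])

theorem IGNDefinableVec.dss (hH : IGNDefinableRel G fun i k v w => (H i k).Adj v w)
    (hV : IGNDefinableRel G fun i k v _ => v ∈ V i k) {x : ∀ i, BagFeat (G i).n a}
    (hx : IGNDefinableVec G fun i k v _ => x i k v) (L : DSSLayer a b) :
    IGNDefinableVec G fun i k v _ => L.eval σ (H i) (V i) a b (x i) k v := by
  have hy := (IGNDefinableVec.crossSum hV hx).reindex ![1, 0, 0]
  -- Cross sums are viewed as a bag that does not depend on the root, with the adjacency of the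
  -- original graph in each copy.
  have hy' := IGNDefinableVec.neighborSum (x := fun i _ => _root_.crossSum (V i) (x i))
    (IGNDefinableRel.adj.reindex ![1, 2, 0]) hy
  exact ((((hx.mulVec L.W₁).add ((IGNDefinableVec.neighborSum hH hx).mulVec L.W₂)).add
    (hy.mulVec L.U₁)).add (hy'.mulVec L.U₂)).comp σ

theorem IGNDefinableVec.ak (hH : IGNDefinableRel G fun i k v w => (H i k).Adj v w)
    (hV : IGNDefinableRel G fun i k v _ => v ∈ V i k) {x : ∀ i, BagFeat (G i).n a}
    (hx : IGNDefinableVec G fun i k v _ => x i k v) (L : AKLayer a b) :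
    IGNDefinableVec G fun i k v _ => AKLayer.eval σ (H i) (V i) a b L (x i) k v := by
  cases L with
  | sum S =>
    have hy := IGNDefinableVec.morrisStack σ hH hx S
    -- The new value ignores the root: `![1, 1, 0]` extracts `y i i`, and `![1, 0, 0]` moves the
    -- node sum from the root slot to the node slot.
    exact (hy.reindex ![1, 1, 0]).add ((IGNDefinableVec.nodeSum hV hy).reindex ![1, 0, 0])
  | concat S =>
    have hy := IGNDefinableVec.morrisStack σ hH hx S
    exact (hy.reindex ![1, 1, 0]).append ((IGNDefinableVec.nodeSum hV hy).reindex ![1, 0, 0])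

theorem IGNDefinableVec.akCtx (hH : IGNDefinableRel G fun i k v w => (H i k).Adj v w)
    (hV : IGNDefinableRel G fun i k v _ => v ∈ V i k) {x : ∀ i, BagFeat (G i).n a}
    (hx : IGNDefinableVec G fun i k v _ => x i k v) (L : AKCtxLayer a b) :
    IGNDefinableVec G fun i k v _ => AKCtxLayer.eval σ (H i) (V i) a b L (x i) k v := by
  cases L with
  | sum S =>
    have hy := IGNDefinableVec.morrisStack σ hH hx S
    exact ((hy.reindex ![1, 1, 0]).add ((IGNDefinableVec.nodeSum hV hy).reindex ![1, 0, 0])).add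
      ((IGNDefinableVec.crossSum hV hy).reindex ![1, 0, 0])
  | concat S =>
    have hy := IGNDefinableVec.morrisStack σ hH hx S
    exact ((hy.reindex ![1, 1, 0]).append
      ((IGNDefinableVec.nodeSum hV hy).reindex ![1, 0, 0])).append
        ((IGNDefinableVec.crossSum hV hy).reindex ![1, 0, 0])

theorem IGNDefinableVec.id (hH : IGNDefinableRel G fun i k v w => (H i k).Adj v w)
    {x : ∀ i, BagFeat (G i).n a}
    (hx : IGNDefinableVec G fun i k v _ => x i k v) (L : IDLayer a b) :
    IGNDefinableVec G fun i k v _ => L.eval σ (H i) a b (x i) k v := by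
  classical
  have hn := IGNDefinableVec.neighborSum
    (adj := fun i k v w => (H i k).Adj v w ∧ w ≠ k)
    (hH.and (IGNDefinableRel.eq.not.reindex ![2, 0, 0])) hx
  exact (((hx.mulVec L.W₁).add (hn.mulVec L.W₂)).add
    -- Repeating index `0` places the root itself in a node slot, in the adjacency test and in the
    -- message.
    (IGNDefinableVec.ite (hH.reindex ![0, 0, 1]) ((hx.reindex ![0, 0, 0]).mulVec L.W₃)
      IGNDefinableVec.zero)).comp σ

theorem IGNDefinableVec.setStack {x : ∀ i, Fin (G i).n → Fin a → ℝ}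
    (hx : IGNDefinableVec G fun i k _ _ => x i k) (S : Stack SetLayer a b) :
    IGNDefinableVec G fun i k _ _ =>
      S.run (F := fun a => Fin (G i).n → Fin a → ℝ) (SetLayer.eval σ) (x i) k :=
  S.run_induction (F := fun i a => Fin (G i).n → Fin a → ℝ) (fun _ => SetLayer.eval σ)
    (fun _ x => IGNDefinableVec G fun i k _ _ => x i k)
    (fun _ _ L x hx => ((hx.mulVec L.W₁).add
      (IGNDefinableVec.sum_nodes (x := fun i k => L.W₂ *ᵥ x i k) (hx.mulVec L.W₂))).comp σ) x hx

theorem IGNDefinableVec.deepSets {x : ∀ i, Fin (G i).n → Fin a → ℝ}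
    (hx : IGNDefinableVec G fun i k _ _ => x i k) (R : DeepSets a b) :
    IGNDefinableVec G fun i _ _ _ => R.eval σ (x i) := by
  cases R with
  | early φ ψ =>
    exact (IGNDefinableVec.sum_nodes (x := fun i k => φ.eval σ (x i k)) (hx.mlp σ φ)).mlp σ ψ
  | late S ψ => exact (IGNDefinableVec.sum_nodes (hx.setStack σ S)).mlp σ ψ

theorem IGNDefinableVec.markRoot :
    IGNDefinableVec G fun i k v _ => markRoot (G i).feat k v := by
  intro c
  induction c using Fin.lastCases with
  | last =>
    simpa [_root_.markRoot] using IGNDefinable.ite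
      (P := fun i k v _ => v = k) (IGNDefinableRel.eq.reindex ![1, 0, 0])
        (IGNDefinable.const 1) (IGNDefinable.const 0)
  | cast c => simpa [_root_.markRoot] using (IGNDefinableVec.feat c).reindex ![1, 0, 0]

theorem IGNDefinableVec.policyFeat (π : Policy) :
    IGNDefinableVec G fun i k v _ => π.feat (G i).feat k v := by
  cases π with
  | nodeDeletion => exact IGNDefinableVec.feat.reindex ![1, 0, 0]
  | nodeMarking => exact IGNDefinableVec.markRoot
  | ego h hpos => exact IGNDefinableVec.feat.reindex ![1, 0, 0]
  | egoMarked h hpos => exact IGNDefinableVec.markRoot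

theorem IGNDefinableVec.evalDS (c : NodeConvention) (π : Policy)
    (S : Stack MorrisLayer (π.dim d) a) (R : DeepSets a b) :
    IGNDefinableVec G fun i _ _ _ => evalDS σ c (G i) π S R :=
  IGNDefinableVec.deepSets σ (IGNDefinableVec.nodeSum (IGNDefinableRel.policy_mem_nodes π c)
    (IGNDefinableVec.morrisStack σ (IGNDefinableRel.policy_adj π)
      (IGNDefinableVec.policyFeat π) S)) R

theorem IGNDefinableVec.subgraphGNN (c : NodeConvention) (N : SubgraphGNN d b) :
    IGNDefinableVec G fun i _ _ _ => N.eval σ c (G i) := by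
  have hH := fun π => IGNDefinableRel.policy_adj (G := G) π
  have hV := fun π => IGNDefinableRel.policy_mem_nodes (G := G) π c
  have hx := fun π => IGNDefinableVec.policyFeat (G := G) π
  cases N with
  | reconstruction S R => exact IGNDefinableVec.evalDS σ c .nodeDeletion S R
  | gnnAK h hpos S μ =>
    have hS := S.run_induction (F := fun i => BagFeat (G i).n) (fun i => AKLayer.eval σ _ _)
      (fun _ x => IGNDefinableVec G fun i k v _ => x i k v)
      (fun _ _ L _ hx => IGNDefinableVec.ak σ (hH (.ego h hpos)) (hV (.ego h hpos)) hx L)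
      _ (hx (.ego h hpos))
    exact (IGNDefinableVec.sum_nodes (hS.reindex ![0, 0, 0])).mlp σ μ
  | gnnAKctx h hpos S μ =>
    have hS := S.run_induction (F := fun i => BagFeat (G i).n) (fun i => AKCtxLayer.eval σ _ _)
      (fun _ x => IGNDefinableVec G fun i k v _ => x i k v)
      (fun _ _ L _ hx => IGNDefinableVec.akCtx σ (hH (.ego h hpos)) (hV (.ego h hpos)) hx L)
      _ (hx (.ego h hpos))
    exact (IGNDefinableVec.sum_nodes (hS.reindex ![0, 0, 0])).mlp σ μ
  | ngnn h hpos S γ μ =>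
    have hz := IGNDefinableVec.nodeSum (hV (.ego h hpos))
      (IGNDefinableVec.morrisStack σ (hH (.ego h hpos)) (hx (.ego h hpos)) S)
    have hγ := γ.run_induction (F := fun i a => Fin (G i).n → Fin a → ℝ)
      (fun i => MorrisLayer.eval σ (G i).graph.Adj)
      (fun _ z => IGNDefinableVec G fun i v _ _ => z i v)
      -- A signal on nodes is treated as a bag that is constant in the root, and the result is
      -- restricted to the diagonal.
      (fun _ _ L z hz => (IGNDefinableVec.morris σ (x := fun i _ => z i)
        (IGNDefinableRel.adj.reindex ![1, 2, 0]) (hz.reindex ![1, 0, 0]) L).reindex ![0, 0, 0])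
      _ hz
    exact (IGNDefinableVec.sum_nodes hγ).mlp σ μ
  | idGNN S hpos μ =>
    have hS := S.run_induction (F := fun i => BagFeat (G i).n) (fun i => IDLayer.eval σ _)
      (fun _ x => IGNDefinableVec G fun i k v _ => x i k v)
      (fun _ _ L _ hx => IGNDefinableVec.id σ (hH (.egoMarked S.length hpos)) hx L)
      _ (hx (.egoMarked S.length hpos))
    exact (IGNDefinableVec.sum_nodes (hS.reindex ![0, 0, 0])).mlp σ μ
  | dsGNN π S R => exact IGNDefinableVec.evalDS σ c π S R
  | dssGNN π S R =>
    have hS := S.run_induction (F := fun i => BagFeat (G i).n) (fun i => DSSLayer.eval σ _ _)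
      (fun _ x => IGNDefinableVec G fun i k v _ => x i k v)
      (fun _ _ L _ hx => IGNDefinableVec.dss σ (hH π) (hV π) hx L) _ (hx π)
    exact IGNDefinableVec.deepSets σ (IGNDefinableVec.nodeSum (hV π) hS) R

end Layers

end Definability

/-! ### Separation of the two graphs -/

theorem theorem1 {d out : ℕ} (σ : ℝ → ℝ) (c : NodeConvention) (G₁ G₂ : AttrGraph d)
    (hiso : ¬ G₁.Isomorphic G₂) (N : SubgraphGNN d out)
    (hN : N.eval σ c G₁ ≠ N.eval σ c G₂) :
    ∃ M : IGN3 d out, M.eval G₁ ≠ M.eval G₂ := by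
  obtain ⟨o, ho⟩ := Function.ne_iff.1 hN
  by_cases hn : G₁.n = G₂.n
  -- The pooled sum carries a factor `n ^ 3`, which must be nonzero; two empty graphs would be
  -- isomorphic.
  · have hpos : G₁.n ≠ 0 := by
      intro h₁
      have h₂ : G₂.n = 0 := hn ▸ h₁
      have : IsEmpty (Fin G₁.n) := by rw [h₁]; infer_instance
      have : IsEmpty (Fin G₂.n) := by rw [h₂]; infer_instance
      exact hiso ⟨⟨Equiv.equivOfIsEmpty _ _, fun {v} => isEmptyElim v⟩, fun v => isEmptyElim v⟩
    have hf := IGNDefinableVec.subgraphGNN (G := fun j : Bool => cond j G₁ G₂) σ c N o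
    refine hf.exists_separating (i := true) (j := false) ?_ o
    simp only [Finset.sum_const, Finset.card_univ, Fintype.card_pi, Fintype.card_fin,
      nsmul_eq_mul, cond_true, cond_false, ← hn]
    exact fun h => ho (mul_left_cancel₀ (by simpa using hpos) h)
  -- Different sizes are separated without the model: the constant `1` sums to `n ^ 3`, which is
  -- injective in `n`.
  · refine (IGNDefinable.const (G := fun j : Bool => cond j G₁ G₂) 1).exists_separating
      (i := true) (j := false) ?_ o
    simp only [Finset.sum_const, Finset.card_univ, Fintype.card_pi, Fintype.card_fin,
      nsmul_eq_mul, cond_true, cond_false, mul_one, Finset.prod_const]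
    exact fun h => hn (Nat.pow_left_injective (n := 3) (by norm_num) (by exact_mod_cast h))
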